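/- Let $K$ be a field. A lattice polytope is a convex polytope $P \subset \mathbb{R}^d$ all of whose vertices lie in $\mathbb{Z}^d$. A lattice polytope $P \subset \mathbb{R}^d$ of dimension $d$ is reflexive if the origin lies in its interior and its dual polytope $P^\vee = \{x \in \mathbb{R}^d : \langle x, y\rangle \le 1 \text{ for all } y \in P\}$ is a lattice polytope. The toric ring $K[P]$ of a lattice polytope $P \subset \mathbb{R}^d$ is the $K$-subalgebra of $K[t_1^{\pm 1}, \ldots, t_d^{\pm 1}, s]$ generated by the monomials $t_1^{a_1}\cdots t_d^{a_d}s$ with $(a_1,\ldots,a_d) \in P \cap \mathbb{Z}^d$, and $\operatorname{depth} K[P]$ is the supremum of the lengths of the $K[P]$-regular sequences contained in the graded maximal ideal of $K[P]$, i.e. the ideal generated by these monomials. The bipyramid of $P$ is $$\operatorname{bipyr}(P) = \operatorname{conv}\bigl(\{(a,0) : a \in P\} \cup \{(0,\ldots,0,1), (0,\ldots,0,-1)\}\bigr) \subset \mathbb{R}^{d+1}.$$ If $P \subset \mathbb{R}^d$ is a reflexive polytope of dimension $d$, then $\operatorname{bipyr}(P) \subset \mathbb{R}^{d+1}$ is a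 reflexive polytope of dimension $d+1$, and $$\operatorname{depth} K[\operatorname{bipyr}(P)] = \operatorname{depth} K[P] + 1.$$ -/

import Mathlib

open scoped Matrix

noncomputable section

namespace ReflexiveDepth

/-- A convex polytope in `ℝ^d`: the convex hull of a finite set of points. -/
def IsPolytope {d : ℕ} (P : Set (Fin d → ℝ)) : Prop :=
  ∃ F : Set (Fin d → ℝ), F.Finite ∧ P = convexHull ℝ F

/-- The inclusion `ℤ^d ⊆ ℝ^d`. -/
def latticePoint {d : ℕ} (a : Fin d → ℤ) : Fin d → ℝ := fun i => (a i : ℝ)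

/-- A lattice polytope: a convex polytope each of whose vertices lies in `ℤ^d`.
The vertices of a convex polytope are its extreme points. -/
def IsLatticePolytope {d : ℕ} (P : Set (Fin d → ℝ)) : Prop :=
  IsPolytope P ∧ P.extremePoints ℝ ⊆ Set.range latticePoint

/-- The dimension of a (nonempty) convex polytope: the dimension of its affine hull. -/
def polytopeDim {d : ℕ} (P : Set (Fin d → ℝ)) : ℕ :=
  Module.finrank ℝ (vectorSpan ℝ P)

/-- The dual polytope `{x | ⟨x, y⟩ ≤ 1 for all y ∈ P}`, for the canonical inner product. -/
def dualPolytope {d : ℕ} (P : Set (Fin d → ℝ)) : Set (Fin d → ℝ) :=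
  {x | ∀ y ∈ P, x ⬝ᵥ y ≤ 1}

/-- A reflexive polytope: a lattice polytope in `ℝ^d` of dimension `d` which contains the origin
in its interior and whose dual polytope is a lattice polytope. -/
structure IsReflexive {d : ℕ} (P : Set (Fin d → ℝ)) : Prop where
  isLatticePolytope : IsLatticePolytope P
  dim_eq : polytopeDim P = d
  zero_mem_interior : (0 : Fin d → ℝ) ∈ interior P
  isLatticePolytope_dual : IsLatticePolytope (dualPolytope P)

/-- The point `(a, h)` of `ℝ^(d+1)` for `a ∈ ℝ^d` and `h ∈ ℝ`. -/
def appendCoord {d : ℕ} (a : Fin d → ℝ) (h : ℝ) : Fin (d + 1) → ℝ :=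
  Fin.snoc (α := fun _ => ℝ) a h

/-- The bipyramid of `P`: the convex hull of `P × {0}` and the points `(0, …, 0, ±1)`. -/
def bipyr {d : ℕ} (P : Set (Fin d → ℝ)) : Set (Fin (d + 1) → ℝ) :=
  convexHull ℝ ((fun a => appendCoord a 0) '' P ∪ {appendCoord 0 1, appendCoord 0 (-1)})

/-- The ring `K[t₁, …, t_d, t₁⁻¹, …, t_d⁻¹, s]`, as the algebra of the monoid `ℤ^d × ℕ` of the
exponents of its monomials. -/
abbrev LaurentRing (K : Type*) [Field K] (d : ℕ) : Type _ :=
  AddMonoidAlgebra K ((Fin d → ℤ) × ℕ)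

/-- The Laurent monomial `t₁^(a₁) ⋯ t_d^(a_d) s`. -/
def laurentMonomial (K : Type*) [Field K] {d : ℕ} (a : Fin d → ℤ) : LaurentRing K d :=
  AddMonoidAlgebra.single (a, 1) 1

/-- The toric ring `K[P]`: the subring generated over `K` by the monomials `t^a s` with
`a ∈ P ∩ ℤ^d`. -/
def toricRing (K : Type*) [Field K] {d : ℕ} (P : Set (Fin d → ℝ)) :
    Subalgebra K (LaurentRing K d) :=
  Algebra.adjoin K {f | ∃ a : Fin d → ℤ, latticePoint a ∈ P ∧ f = laurentMonomial K a}

/-- The graded maximal ideal of `K[P]` (graded by the exponent of `s`): the ideal generated by the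
monomials `t^a s` with `a ∈ P ∩ ℤ^d`. -/
def toricMaximalIdeal (K : Type*) [Field K] {d : ℕ} (P : Set (Fin d → ℝ)) :
    Ideal (toricRing K P) :=
  Ideal.span {f | ∃ a : Fin d → ℤ, latticePoint a ∈ P ∧ (f : LaurentRing K d) = laurentMonomial K a}

/-- The supremum of the lengths of the `R`-regular sequences in the ideal `I`. -/
def idealGrade {R : Type*} [CommRing R] (I : Ideal R) : ℕ∞ :=
  ⨆ rs ∈ {rs : List R | (∀ r ∈ rs, r ∈ I) ∧ RingTheory.Sequence.IsRegular R rs}, (rs.length : ℕ∞)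

/-- The depth of the toric ring `K[P]`: the supremum of the lengths of the regular sequences in
its graded maximal ideal. -/
def toricDepth (K : Type*) [Field K] {d : ℕ} (P : Set (Fin d → ℝ)) : ℕ∞ :=
  idealGrade (toricMaximalIdeal K P)

end ReflexiveDepth

end

/-! The dual of the bipyramid is the prism `P^∨ × [-1, 1]`, so reflexivity passes to it. For the
depth, the lattice points of the bipyramid are those of `P × {0}` and the two apexes. Put `R =
K[P]`, let `m` be its graded maximal ideal and let `s ∈ m` be the monomial of the origin. The apex
monomials `x`, `y` satisfy `x y = s²`, and this is the only new relation: `K[bipyr P] ≅ R[x, y]/(xy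
- s²)` (`toricDepth_eq_add_one`, `hyperbolaLift_injective`).

That this extension raises the grade by one (`idealGrade_hyperbolaIdeal`) holds for any proper ideal
`m` containing `s` in a Noetherian ring `R`. The new ring is free over `R[U]`, `U = x + y`, with
basis `1, x`, so a regular sequence in `m` stays regular when `U` is appended. Conversely, if `rs`
is a longest regular sequence in `m`, some `w ∉ (rs)` has `m w ⊆ (rs)`. Then `w x` is nonzero modulo
`(rs, U)` and is killed by `m`, `x` and `y`, because `x² ≡ -xy = -s²`. By Ext vanishing no regular
sequence is longer than `(rs, U)`. -/

namespace ReflexiveDepth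

/-! ### Grade of an ideal, by vanishing of Ext. -/

section Depth

open RingTheory.Sequence CategoryTheory Abelian Pointwise

universe u

/-- If `Extⁱ(R/I, M)` vanishes for all `i` up to the length of an `M`-regular sequence in `I`,
then the quotient of `M` by this sequence has no nonzero element annihilated by `I`. -/
theorem eq_zero_of_subsingleton_ext {R : Type u} [CommRing R] (I : Ideal R) (rs : List R)
    (mem : ∀ r ∈ rs, r ∈ I) (M : ModuleCat.{u} R) (reg : IsWeaklyRegular M rs)
    (hext : ∀ i ≤ rs.length, Subsingleton (Ext (ModuleCat.of R (R ⧸ I)) M i))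
    (w : M ⧸ (Ideal.ofList rs • ⊤ : Submodule R M)) (hw : ∀ a ∈ I, a • w = 0) : w = 0 := by
  induction rs generalizing M with
  | nil =>
    let e : (M ⧸ (Ideal.ofList ([] : List R) • ⊤ : Submodule R M)) ≃ₗ[R] M :=
      Submodule.quotEquivOfEqBot _ (by rw [Ideal.ofList_nil, Submodule.bot_smul])
    have h0 : Subsingleton (ModuleCat.of R (R ⧸ I) ⟶ M) :=
      Ext.addEquiv₀.subsingleton_congr.mp (hext 0 le_rfl)
    have h1 : Subsingleton ((R ⧸ I) →ₗ[R] M) := 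
      (ModuleCat.homAddEquiv (M := ModuleCat.of R (R ⧸ I)) (N := M)).symm.subsingleton
    let f : (R ⧸ I) →ₗ[R] M := I.liftQ (LinearMap.toSpanSingleton R M (e w)) fun a ha => by
      rw [LinearMap.mem_ker, LinearMap.toSpanSingleton_apply, ← e.map_smul, hw a ha, e.map_zero]
    have h2 : f (Submodule.Quotient.mk (1 : R)) = 0 := by
      rw [Subsingleton.elim f 0, LinearMap.zero_apply]
    have h3 : e w = 0 := (one_smul R (e w)).symm.trans h2
    exact e.map_eq_zero_iff.mp h3
  | cons a rs ih =>
    rw [isWeaklyRegular_cons_iff] at reg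
    have key := ih (fun r hr => mem r (List.mem_cons_of_mem _ hr))
      (ModuleCat.of R (QuotSMulTop a M)) reg.2 (fun i hi => by
        -- In the long exact sequence of `0 → M → M → M/aM → 0`, `Extⁱ(R/I, M/aM)` lies between
        -- `Extⁱ(R/I, M)` and `Extⁱ⁺¹(R/I, M)`; dropping `a` from the sequence pays for the shift of
        -- degree.
        have zero1 := AddCommGrpCat.isZero_of_iff_subsingleton.mpr
          (hext i (by simp only [List.length_cons]; omega))
        have zero2 := AddCommGrpCat.isZero_of_iff_subsingleton.mpr
          (hext (i + 1) (by simp only [List.length_cons]; omega))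
        exact AddCommGrpCat.subsingleton_of_isZero <| ShortComplex.Exact.isZero_of_both_zeros
          ((Ext.covariant_sequence_exact₃' (ModuleCat.of R (R ⧸ I))
            reg.1.smulShortComplex_shortExact) i (i + 1) rfl)
          (zero1.eq_zero_of_src _) (zero2.eq_zero_of_tgt _))
      (Submodule.quotOfListConsSMulTopEquivQuotSMulTopInner M a rs w)
      (fun b hb => by rw [← map_smul, hw b hb, map_zero])
    exact (Submodule.quotOfListConsSMulTopEquivQuotSMulTopInner M a rs).map_eq_zero_iff.mp key

/-- A regular sequence in `I` modulo which `I` annihilates a nonzero element is at least as long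
as every other regular sequence in `I`. -/
theorem length_le_of_annihilated {R : Type u} [CommRing R] [IsNoetherianRing R] {I : Ideal R}
    {rs ys : List R} (hI : I ≠ ⊤) (mem : ∀ r ∈ rs, r ∈ I) (reg : IsWeaklyRegular R rs)
    {w : R} (hw : w ∉ Ideal.ofList rs) (hIw : ∀ a ∈ I, a * w ∈ Ideal.ofList rs)
    (ymem : ∀ r ∈ ys, r ∈ I) (yreg : IsRegular R ys) : ys.length ≤ rs.length := by
  by_contra! hlt
  refine hw ?_
  -- Rees: the sequence `ys` forces `Extⁱ(R/I, R) = 0` for `i < ys.length`, hence for all `i ≤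
  -- rs.length`.
  have h := eq_zero_of_subsingleton_ext I rs mem (ModuleCat.of R R) reg
    (fun i hi => ModuleCat.subsingleton_ext_of_exists_isRegular I (ModuleCat.of R (R ⧸ I))
      (by rw [Module.support_eq_zeroLocus, Ideal.annihilator_quotient]) (ModuleCat.of R R)
      (by simpa using hI.lt_top) ys ymem yreg i (by omega))
    (Submodule.Quotient.mk w) (fun a ha => by
      rw [← Submodule.Quotient.mk_smul, Submodule.Quotient.mk_eq_zero]
      simpa using hIw a ha)
  rw [Submodule.Quotient.mk_eq_zero] at h
  simpa using h

theorem isRegular_of_isWeaklyRegular {R : Type*} [CommRing R] {I : Ideal R} (hI : I ≠ ⊤)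
    {rs : List R} (mem : ∀ r ∈ rs, r ∈ I) (reg : IsWeaklyRegular R rs) : IsRegular R rs := by
  refine ⟨reg, fun h => hI (top_le_iff.mp ?_)⟩
  rw [h, smul_eq_mul, Ideal.mul_top]
  exact Ideal.span_le.mpr mem

theorem length_le_idealGrade {R : Type*} [CommRing R] {I : Ideal R} {rs : List R}
    (mem : ∀ r ∈ rs, r ∈ I) (reg : IsRegular R rs) : (rs.length : ℕ∞) ≤ idealGrade I :=
  le_iSup₂_of_le rs ⟨mem, reg⟩ le_rfl

theorem idealGrade_le {R : Type*} [CommRing R] {I : Ideal R} {n : ℕ∞}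
    (h : ∀ rs : List R, (∀ r ∈ rs, r ∈ I) → IsRegular R rs → (rs.length : ℕ∞) ≤ n) :
    idealGrade I ≤ n :=
  iSup₂_le fun rs hrs => h rs hrs.1 hrs.2

theorem idealGrade_le_of_ringEquiv {R S : Type*} [CommRing R] [CommRing S] (e : R ≃+* S)
    {I : Ideal R} {J : Ideal S} (h : I.map e ≤ J) : idealGrade I ≤ idealGrade J := by
  refine idealGrade_le fun rs mem reg => ?_
  rw [← List.length_map (as := rs) e]
  refine length_le_idealGrade (fun r hr => ?_) ?_
  · obtain ⟨r, hr', rfl⟩ := List.mem_map.mp hr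
    exact h (Ideal.mem_map_of_mem e (mem r hr'))
  · refine (AddEquiv.isRegular_congr (e := e.toAddEquiv) ?_).mp reg
    rw [List.forall₂_map_right_iff]
    exact List.forall₂_same.mpr fun r _ x => e.map_mul r x

theorem idealGrade_eq_of_ringEquiv {R S : Type*} [CommRing R] [CommRing S] (e : R ≃+* S)
    {I : Ideal R} {J : Ideal S} (h : I.map e = J) : idealGrade I = idealGrade J := by
  refine le_antisymm (idealGrade_le_of_ringEquiv e h.le) (idealGrade_le_of_ringEquiv e.symm ?_)
  rw [← h, Ideal.map_le_iff_le_comap, Ideal.map_le_iff_le_comap]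
  intro a ha
  simpa [Ideal.mem_comap] using ha

/-- A longest regular sequence in `I` exists if `I` has finite grade, and modulo such a sequence
some nonzero element is annihilated by `I`. -/
theorem exists_maximal_regular {R : Type*} [CommRing R] [IsNoetherianRing R] {I : Ideal R}
    (hI : I ≠ ⊤) (hfin : idealGrade I ≠ ⊤) :
    ∃ rs : List R, (∀ r ∈ rs, r ∈ I) ∧ IsRegular R rs ∧
      ∃ w, w ∉ Ideal.ofList rs ∧ ∀ a ∈ I, a * w ∈ Ideal.ofList rs := by
  have : Nontrivial R := (Submodule.nontrivial_iff R).mp ⟨⟨I, ⊤, hI⟩⟩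
  obtain ⟨n, hn⟩ := ENat.ne_top_iff_exists.mp hfin
  have hex : ∃ k, ∃ rs : List R, (∀ r ∈ rs, r ∈ I) ∧ IsRegular R rs ∧ n = rs.length + k :=
    ⟨n, [], by simp, IsRegular.nil R R, by simp⟩
  classical
  -- Minimizing the gap `k` between the length and the grade yields a longest sequence.
  obtain ⟨rs, mem, reg, hlen⟩ := Nat.find_spec hex
  refine ⟨rs, mem, reg, ?_⟩
  by_contra! hno
  let M := R ⧸ (Ideal.ofList rs • ⊤ : Submodule R R)
  -- A map `R/I → M` is an element of `M` killed by `I`. If there is none but zero, the Noetherian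
  -- hypothesis puts an `M`-regular element in `I`, which would lengthen `rs`.
  have hsub : Subsingleton ((R ⧸ I) →ₗ[R] M) := by
    refine subsingleton_of_forall_eq 0 fun f => ?_
    obtain ⟨w, hw⟩ := Submodule.Quotient.mk_surjective _ (f (Submodule.Quotient.mk 1))
    have hf1 : f (Submodule.Quotient.mk 1) = 0 := by
      by_contra hne
      rw [← hw, Submodule.Quotient.mk_eq_zero] at hne
      obtain ⟨a, ha, haw⟩ := hno w (by simpa using hne)
      apply haw
      have h0 : a • f (Submodule.Quotient.mk 1) = 0 := by
        rw [← map_smul, ← Submodule.Quotient.mk_smul,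
          (Submodule.Quotient.mk_eq_zero _).mpr (by simpa using ha), map_zero]
      rw [← hw, ← Submodule.Quotient.mk_smul, Submodule.Quotient.mk_eq_zero] at h0
      simpa using h0
    ext
    simpa using hf1
  obtain ⟨a, ha, hreg⟩ := IsSMulRegular.subsingleton_linearMap_iff.mp hsub
  rw [Ideal.annihilator_quotient] at ha
  have mem' : ∀ r ∈ rs ++ [a], r ∈ I := by
    intro r hr
    rcases List.mem_append.mp hr with h | h
    · exact mem r h
    · rwa [List.mem_singleton.mp h]
  have reg' : IsRegular R (rs ++ [a]) := isRegular_of_isWeaklyRegular hI mem' <|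
    (isWeaklyRegular_append_iff R rs [a]).mpr
      ⟨reg.toIsWeaklyRegular, (isWeaklyRegular_singleton_iff _ a).mpr hreg⟩
  have hle := length_le_idealGrade mem' reg'
  rw [← hn, Nat.cast_le, List.length_append, List.length_singleton] at hle
  have := Nat.find_min' hex (m := Nat.find hex - 1) ⟨rs ++ [a], mem', reg', by simp; omega⟩
  omega

end Depth
-- The extension `R[x, y]/(xy - s²)` and its grade.
section HyperbolaRing

open RingTheory.Sequence Polynomial

universe u

variable {R : Type u} [CommRing R]

/-- The quadratic polynomial `X² - U X + s²` over `R[U]`, whose roots `x, y` satisfy `x + y = U`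
and `x y = s²`. -/
noncomputable def hyperbolaPoly (s : R) : R[X][X] := X ^ 2 - C X * X + C (C (s ^ 2))

theorem hyperbolaPoly_eq (s : R) :
    hyperbolaPoly s = C 1 * X ^ 2 + C (-X) * X + C (C (s ^ 2)) := by
  rw [hyperbolaPoly, C_1, one_mul, C_neg]
  ring

theorem hyperbolaPoly_monic [Nontrivial R] (s : R) : (hyperbolaPoly s).Monic := by
  rw [hyperbolaPoly_eq, Monic, leadingCoeff_quadratic one_ne_zero]

theorem hyperbolaPoly_natDegree [Nontrivial R] (s : R) : (hyperbolaPoly s).natDegree = 2 := by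
  rw [hyperbolaPoly_eq, natDegree_quadratic one_ne_zero]

/-- The ring `R[x, y]/(xy - s²)`, presented as a free module of rank two over `R[x + y]`. -/
abbrev HyperbolaRing (s : R) : Type u := AdjoinRoot (hyperbolaPoly s)

/-- The structure map `R → R[x, y]/(xy - s²)`. -/
noncomputable def hyperbolaC (s : R) : R →+* HyperbolaRing s :=
  (AdjoinRoot.of (hyperbolaPoly s)).comp C

/-- The element `x` of `R[x, y]/(xy - s²)`. -/
noncomputable def hyperbolaX (s : R) : HyperbolaRing s := AdjoinRoot.root (hyperbolaPoly s)

/-- The element `y` of `R[x, y]/(xy - s²)`. -/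
noncomputable def hyperbolaY (s : R) : HyperbolaRing s :=
  AdjoinRoot.of (hyperbolaPoly s) X - hyperbolaX s

theorem hyperbolaX_add_hyperbolaY (s : R) :
    hyperbolaX s + hyperbolaY s = AdjoinRoot.of (hyperbolaPoly s) X := by
  simp [hyperbolaY]

theorem hyperbolaX_mul_hyperbolaY (s : R) :
    hyperbolaX s * hyperbolaY s = hyperbolaC s (s ^ 2) := by
  have h : hyperbolaX s ^ 2 - AdjoinRoot.of (hyperbolaPoly s) X * hyperbolaX s +
      hyperbolaC s (s ^ 2) = 0 := by
    have h0 := AdjoinRoot.mk_self (f := hyperbolaPoly s)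
    have h1 : AdjoinRoot.mk (hyperbolaPoly s) (X ^ 2 - C X * X + C (C (s ^ 2))) = 0 := h0
    simp only [map_add, map_sub, map_mul, map_pow, AdjoinRoot.mk_X, AdjoinRoot.mk_C] at h1
    rw [map_pow]
    exact h1
  rw [hyperbolaY]
  linear_combination -h

/-- The ideal of `R[x, y]/(xy - s²)` generated by `m`, `x` and `y`. -/
noncomputable def hyperbolaIdeal (m : Ideal R) (s : R) : Ideal (HyperbolaRing s) :=
  m.map (hyperbolaC s) ⊔ Ideal.span {hyperbolaX s, hyperbolaY s}

theorem hyperbolaC_mem {m : Ideal R} (s : R) {a : R} (ha : a ∈ m) :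
    hyperbolaC s a ∈ hyperbolaIdeal m s :=
  Ideal.mem_sup_left (Ideal.mem_map_of_mem _ ha)

theorem hyperbolaX_mem (m : Ideal R) (s : R) : hyperbolaX s ∈ hyperbolaIdeal m s :=
  Ideal.mem_sup_right (Ideal.subset_span (by simp))

theorem hyperbolaY_mem (m : Ideal R) (s : R) : hyperbolaY s ∈ hyperbolaIdeal m s :=
  Ideal.mem_sup_right (Ideal.subset_span (by simp))

/-- The ring map `R[x, y]/(xy - s²) → (R/J)[x]/(x² + s²)` with `y ↦ -x`. -/
noncomputable def hyperbolaReduce (J : Ideal R) (s : R) : HyperbolaRing s →+*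
    AdjoinRoot (X ^ 2 + C (Ideal.Quotient.mk J s ^ 2)) :=
  AdjoinRoot.lift ((AdjoinRoot.of _).comp (eval₂RingHom (Ideal.Quotient.mk J) 0))
    (AdjoinRoot.root _) (by
      have h := AdjoinRoot.eval₂_root (X ^ 2 + C (Ideal.Quotient.mk J s ^ 2))
      simp only [eval₂_add, eval₂_X_pow, map_pow] at h
      simp only [hyperbolaPoly, eval₂_add, eval₂_sub, eval₂_mul, eval₂_X_pow, eval₂_C, eval₂_X]
      simpa only [RingHom.comp_apply, coe_eval₂RingHom, eval₂_X, eval₂_C, eval₂_pow, map_zero,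
        zero_mul, sub_zero, map_pow] using h)

theorem hyperbolaReduce_C (J : Ideal R) (s a : R) :
    hyperbolaReduce J s (hyperbolaC s a) = AdjoinRoot.of _ (Ideal.Quotient.mk J a) := by
  simp [hyperbolaReduce, hyperbolaC, AdjoinRoot.lift_of]

theorem hyperbolaReduce_X (J : Ideal R) (s : R) :
    hyperbolaReduce J s (hyperbolaX s) = AdjoinRoot.root _ := by
  simp [hyperbolaReduce, hyperbolaX, AdjoinRoot.lift_root]

theorem hyperbolaReduce_of_X (J : Ideal R) (s : R) :
    hyperbolaReduce J s (AdjoinRoot.of (hyperbolaPoly s) X) = 0 := by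
  simp [hyperbolaReduce, AdjoinRoot.lift_of]

theorem hyperbolaReduce_Y (J : Ideal R) (s : R) :
    hyperbolaReduce J s (hyperbolaY s) = -AdjoinRoot.root _ := by
  rw [hyperbolaY, map_sub, hyperbolaReduce_X, hyperbolaReduce_of_X, zero_sub]

/-- Used contrapositively, to certify that `w x` is not in the ideal `(rs, x + y)`. -/
theorem hyperbolaReduce_eq_zero {rs : List R} {s : R} {a : HyperbolaRing s}
    (ha : a ∈ Ideal.ofList (rs.map (hyperbolaC s) ++ [hyperbolaX s + hyperbolaY s])) :
    hyperbolaReduce (Ideal.ofList rs) s a = 0 := by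
  rw [← RingHom.mem_ker]
  refine Ideal.span_le.mpr ?_ ha
  intro b hb
  rw [Set.mem_ofPred_eq, List.mem_append, List.mem_map, List.mem_singleton] at hb
  rw [SetLike.mem_coe, RingHom.mem_ker]
  rcases hb with ⟨r, hr, rfl⟩ | rfl
  · have h0 : Ideal.Quotient.mk (Ideal.ofList rs) r = 0 :=
      Ideal.Quotient.eq_zero_iff_mem.mpr (Ideal.subset_span hr)
    rw [hyperbolaReduce_C, h0, map_zero]
  · rw [hyperbolaX_add_hyperbolaY, hyperbolaReduce_of_X]

/-- A nonzero polynomial of degree one is not divisible by a monic quadratic. -/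
theorem hyperbolaReduce_C_mul_X_ne_zero {J : Ideal R} (s : R) {w : R} (hw : w ∉ J) :
    hyperbolaReduce J s (hyperbolaC s w * hyperbolaX s) ≠ 0 := by
  have hw' : Ideal.Quotient.mk J w ≠ 0 := fun h => hw (Ideal.Quotient.eq_zero_iff_mem.mp h)
  have : Nontrivial (R ⧸ J) := ⟨⟨_, _, hw'⟩⟩
  rw [map_mul, hyperbolaReduce_C, hyperbolaReduce_X]
  intro h
  have h1 : AdjoinRoot.mk (X ^ 2 + C (Ideal.Quotient.mk J s ^ 2))
      (C (Ideal.Quotient.mk J w) * X) = 0 := by simpa using h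
  have hmon : (X ^ 2 + C (Ideal.Quotient.mk J s ^ 2) : (R ⧸ J)[X]).Monic :=
    monic_X_pow_add_C _ two_ne_zero
  rw [AdjoinRoot.mk_eq_zero] at h1
  refine hmon.not_dvd_of_natDegree_lt ?_ ?_ h1
  · intro h0
    apply hw'
    simpa using congrArg (coeff · 1) h0
  · rw [natDegree_C_mul_X _ hw', natDegree_X_pow_add_C]
    exact one_lt_two

/-- Since `s` vanishes in `R/m`, zero is a root of `X² + s²` there, so `x, y ↦ 0` defines a map to
the nonzero ring `R/m` which kills the ideal. -/
theorem hyperbolaIdeal_ne_top {m : Ideal R} (hm : m ≠ ⊤) {s : R} (hs : s ∈ m) :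
    hyperbolaIdeal m s ≠ ⊤ := by
  have : Nontrivial (R ⧸ m) := Ideal.Quotient.nontrivial_iff.mpr hm
  let f : HyperbolaRing s →+* R ⧸ m :=
    (AdjoinRoot.lift (RingHom.id (R ⧸ m)) 0 (by
      rw [Ideal.Quotient.eq_zero_iff_mem.mpr hs]
      simp)).comp (hyperbolaReduce m s)
  have hle : hyperbolaIdeal m s ≤ RingHom.ker f := by
    refine sup_le (Ideal.map_le_iff_le_comap.mpr fun r hr => ?_) (Ideal.span_le.mpr ?_)
    · simpa [f, hyperbolaReduce_C, Ideal.mem_comap, RingHom.mem_ker, AdjoinRoot.lift_of]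
        using Ideal.Quotient.eq_zero_iff_mem.mpr hr
    · rintro b (rfl | rfl)
      · simp [f, hyperbolaReduce_X, RingHom.mem_ker, AdjoinRoot.lift_root]
      · simp [f, hyperbolaReduce_Y, RingHom.mem_ker, AdjoinRoot.lift_root]
  intro h
  exact RingHom.ker_ne_top f (top_le_iff.mp (h ▸ hle))

/-- Weak regularity survives the flat maps `R → R[U]` and `R[U] → R[x, y]/(xy - s²)`; between them,
`U` is a nonzerodivisor on `R[U]/(rs)` because multiplying by it shifts coefficients. -/
theorem hyperbola_isWeaklyRegular [Nontrivial R] (s : R) {rs : List R}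
    (reg : IsWeaklyRegular R rs) :
    IsWeaklyRegular (HyperbolaRing s)
      (rs.map (hyperbolaC s) ++ [hyperbolaX s + hyperbolaY s]) := by
  have : Module.Free R[X] (HyperbolaRing s) := (hyperbolaPoly_monic s).free_adjoinRoot
  have h1 : IsWeaklyRegular R[X] (rs.map (C : R →+* R[X]) ++ [(X : R[X])]) := by
    refine (isWeaklyRegular_append_iff _ _ _).mpr ⟨reg.of_flat, ?_⟩
    rw [isWeaklyRegular_singleton_iff, isSMulRegular_iff_right_eq_zero_of_smul]
    intro p hp
    obtain ⟨p, rfl⟩ := Submodule.Quotient.mk_surjective _ p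
    have hI : (Ideal.ofList (rs.map (C : R →+* R[X])) • ⊤ : Submodule R[X] R[X]) =
        (Ideal.ofList rs).map C := by
      rw [← Ideal.map_ofList, smul_eq_mul, Ideal.mul_top]
    rw [← Submodule.Quotient.mk_smul, Submodule.Quotient.mk_eq_zero, hI,
      Ideal.mem_map_C_iff] at hp
    rw [Submodule.Quotient.mk_eq_zero, hI, Ideal.mem_map_C_iff]
    intro n
    simpa using hp (n + 1)
  have h2 := h1.of_flat (S := HyperbolaRing s)
  rw [hyperbolaX_add_hyperbolaY]
  simpa [hyperbolaC, AdjoinRoot.algebraMap_eq, Function.comp_def] using h2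

/-- Modulo `x + y`, both `x · wx` and `y · wx` are `±w s²`, which lies in `(rs)` because `s² ∈ m`.
-/
theorem hyperbolaIdeal_annihilates {m : Ideal R} {s : R} (hs : s ∈ m) {rs : List R} {w : R}
    (hw : ∀ a ∈ m, a * w ∈ Ideal.ofList rs) (a : HyperbolaRing s) (ha : a ∈ hyperbolaIdeal m s) :
    a * (hyperbolaC s w * hyperbolaX s) ∈
      Ideal.ofList (rs.map (hyperbolaC s) ++ [hyperbolaX s + hyperbolaY s]) := by
  set J := Ideal.ofList (rs.map (hyperbolaC s) ++ [hyperbolaX s + hyperbolaY s]) with hJ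
  have hC : ∀ r ∈ Ideal.ofList rs, hyperbolaC s r ∈ J := by
    intro r hr
    have := Ideal.mem_map_of_mem (hyperbolaC s) hr
    rw [Ideal.map_ofList] at this
    rw [hJ, Ideal.ofList_append]
    exact Ideal.mem_sup_left this
  have hU : hyperbolaX s + hyperbolaY s ∈ J := Ideal.subset_span (by simp)
  have hY : hyperbolaC s w * (hyperbolaX s * hyperbolaY s) ∈ J := by
    rw [hyperbolaX_mul_hyperbolaY, ← map_mul]
    exact hC _ (by rw [mul_comm]; exact hw _ (Ideal.pow_mem_of_mem m hs 2 two_pos))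
  suffices h : hyperbolaIdeal m s ≤
      Submodule.comap (LinearMap.mulRight (HyperbolaRing s) (hyperbolaC s w * hyperbolaX s)) J by
    exact h ha
  refine sup_le (Ideal.map_le_iff_le_comap.mpr fun r hr => ?_) (Ideal.span_le.mpr ?_)
  · change hyperbolaC s r * (hyperbolaC s w * hyperbolaX s) ∈ J
    rw [← mul_assoc, ← map_mul]
    exact J.mul_mem_right _ (hC _ (hw r hr))
  · rintro b (rfl | rfl)
    · change hyperbolaX s * (hyperbolaC s w * hyperbolaX s) ∈ J
      have : hyperbolaX s * (hyperbolaC s w * hyperbolaX s) =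
          hyperbolaC s w * hyperbolaX s * (hyperbolaX s + hyperbolaY s) -
            hyperbolaC s w * (hyperbolaX s * hyperbolaY s) := by ring
      rw [this]
      exact J.sub_mem (J.mul_mem_left _ hU) hY
    · change hyperbolaY s * (hyperbolaC s w * hyperbolaX s) ∈ J
      have : hyperbolaY s * (hyperbolaC s w * hyperbolaX s) =
          hyperbolaC s w * (hyperbolaX s * hyperbolaY s) := by ring
      rw [this]
      exact hY

/-- Passing from `R` to `R[x, y]/(xy - s²)` raises the grade of an ideal containing `s` by one. -/
theorem idealGrade_hyperbolaIdeal [IsNoetherianRing R] {m : Ideal R} (hm : m ≠ ⊤) {s : R}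
    (hs : s ∈ m) : idealGrade (hyperbolaIdeal m s) = idealGrade m + 1 := by
  have : Nontrivial R := (Submodule.nontrivial_iff R).mp ⟨⟨m, ⊤, hm⟩⟩
  have htop := hyperbolaIdeal_ne_top hm hs
  have hmem : ∀ rs : List R, (∀ r ∈ rs, r ∈ m) →
      ∀ r ∈ rs.map (hyperbolaC s) ++ [hyperbolaX s + hyperbolaY s], r ∈ hyperbolaIdeal m s := by
    intro rs mem r hr
    rw [List.mem_append, List.mem_map, List.mem_singleton] at hr
    rcases hr with ⟨a, ha, rfl⟩ | rfl
    · exact hyperbolaC_mem s (mem a ha)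
    · exact add_mem (hyperbolaX_mem m s) (hyperbolaY_mem m s)
  refine le_antisymm ?_ ?_
  · by_cases hfin : idealGrade m = ⊤
    · simp [hfin]
    obtain ⟨rs, mem, reg, w, hw, hmw⟩ := exists_maximal_regular hm hfin
    refine idealGrade_le fun ys ymem yreg => ?_
    have hlen := length_le_of_annihilated htop (hmem rs mem)
      (hyperbola_isWeaklyRegular s reg.toIsWeaklyRegular)
      (w := hyperbolaC s w * hyperbolaX s)
      (fun h => hyperbolaReduce_C_mul_X_ne_zero s hw (hyperbolaReduce_eq_zero h))
      (hyperbolaIdeal_annihilates hs hmw) ymem yreg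
    calc (ys.length : ℕ∞) ≤ (rs.length + 1 : ℕ) := by
          rw [Nat.cast_le]
          simpa using hlen
      _ ≤ idealGrade m + 1 := by
          push_cast
          gcongr
          exact length_le_idealGrade mem reg
  -- Moving `+ 1` inside the supremum needs a nonempty index set; the empty sequence belongs to it.
  · rw [idealGrade, ENat.biSup_add (s := {rs : List R | (∀ r ∈ rs, r ∈ m) ∧ IsRegular R rs})
      ⟨[], by simp, IsRegular.nil R R⟩]
    refine iSup₂_le fun rs hrs => ?_
    have h := length_le_idealGrade (hmem rs hrs.1) (isRegular_of_isWeaklyRegular htop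
      (hmem rs hrs.1) (hyperbola_isWeaklyRegular s hrs.2.toIsWeaklyRegular))
    simpa using h

end HyperbolaRing
-- Maps out of the extension, and their injectivity.
section HyperbolaLift

open Polynomial

universe u

variable {R : Type u} [CommRing R] {E : Type*} [CommRing E]

/-- The ring map out of `R[x, y]/(xy - s²)` with prescribed values of `x` and `y`. -/
noncomputable def hyperbolaLift {s : R} (φ : R →+* E) (x y : E) (h : x * y = φ (s ^ 2)) :
    HyperbolaRing s →+* E :=
  AdjoinRoot.lift (eval₂RingHom φ (x + y)) x (by
    simp only [hyperbolaPoly, eval₂_add, eval₂_sub, eval₂_mul, eval₂_X_pow, eval₂_C, eval₂_X,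
      coe_eval₂RingHom, ← h]
    ring)

section

variable {s : R} (φ : R →+* E) (x y : E) (h : x * y = φ (s ^ 2))

theorem hyperbolaLift_C (a : R) : hyperbolaLift φ x y h (hyperbolaC s a) = φ a := by
  simp [hyperbolaLift, hyperbolaC, AdjoinRoot.lift_of]

theorem hyperbolaLift_X : hyperbolaLift φ x y h (hyperbolaX s) = x := by
  simp [hyperbolaLift, hyperbolaX, AdjoinRoot.lift_root]

theorem hyperbolaLift_Y : hyperbolaLift φ x y h (hyperbolaY s) = y := by
  rw [hyperbolaY, map_sub, hyperbolaLift_X]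
  simp [hyperbolaLift, AdjoinRoot.lift_of]

theorem hyperbolaLift_mem {S : Subring E} (hφ : ∀ a, φ a ∈ S) (hx : x ∈ S) (hy : y ∈ S)
    (z : HyperbolaRing s) : hyperbolaLift φ x y h z ∈ S := by
  obtain ⟨p, rfl⟩ := AdjoinRoot.mk_surjective z
  rw [hyperbolaLift, AdjoinRoot.lift_mk, eval₂_eq_sum_range]
  refine S.sum_mem fun i _ => S.mul_mem ?_ (S.pow_mem hx i)
  rw [coe_eval₂RingHom, eval₂_eq_sum_range]
  exact S.sum_mem fun j _ => S.mul_mem (hφ _) (S.pow_mem (S.add_mem hx hy) j)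

end

/-- If `x` is transcendental over the domain `R` and `x y = s²`, then so is `x + y`. -/
theorem eval₂_add_eq_zero [IsDomain E] {s : R} {φ : R →+* E} (hφ : Function.Injective φ) {x y : E}
    (h : x * y = φ (s ^ 2)) (hx : ∀ p : R[X], p.eval₂ φ x = 0 → p = 0) (p : R[X])
    (hp : p.eval₂ φ (x + y) = 0) : p = 0 := by
  let _ := φ.toAlgebra
  have : IsDomain R := hφ.isDomain φ
  by_contra hne
  have hu : IsAlgebraic R (x + y) := ⟨p, hne, hp⟩
  have : Algebra.IsAlgebraic R (Algebra.adjoin R {x + y}) :=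
    (Subalgebra.isAlgebraic_iff _).mp (Algebra.isAlgebraic_adjoin_singleton_iff.mpr hu)
  let u : Algebra.adjoin R {x + y} := ⟨x + y, Algebra.subset_adjoin rfl⟩
  -- `x` is a root of `T² - (x + y) T + s²`, so if `x + y` were algebraic over `R`, then `x` would
  -- be too.
  have hx' : IsAlgebraic (Algebra.adjoin R {x + y}) x := by
    refine ⟨C 1 * X ^ 2 + C (-u) * X + C (algebraMap R _ (s ^ 2)), ?_, ?_⟩
    · intro h0
      have := congrArg natDegree h0
      rw [natDegree_quadratic one_ne_zero, natDegree_zero] at this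
      exact two_ne_zero this
    · have hu : algebraMap (Algebra.adjoin R {x + y}) E u = x + y := rfl
      have hs : algebraMap R E (s ^ 2) = x * y := h.symm
      simp only [map_add, map_mul, map_pow, aeval_C, aeval_X, map_one, map_neg, hu]
      rw [← map_pow, ← map_pow, ← IsScalarTower.algebraMap_apply, hs]
      ring
  obtain ⟨q, hq, hq0⟩ := hx'.restrictScalars R
  exact hq (hx q hq0)

/-- An element of the kernel is `q x + p` with `q, p ∈ R[U]`. The endomorphism `σ` fixes the images
of `q` and `p` and turns the relation into `q y + p = 0`; subtracting gives `q (x - y) = 0`, so `q`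
and then `p` vanish at `x + y`, which is transcendental. -/
theorem hyperbolaLift_injective [IsDomain E] {s : R} {φ : R →+* E} (hφ : Function.Injective φ)
    {x y : E} (h : x * y = φ (s ^ 2)) (hx : ∀ p : R[X], p.eval₂ φ x = 0 → p = 0) (hxy : x ≠ y)
    (σ : E →+* E) (hσ : ∀ a, σ (φ a) = φ a) (hσx : σ x = y) (hσy : σ y = x) :
    Function.Injective (hyperbolaLift φ x y h) := by
  have : Nontrivial R := ⟨⟨0, 1, fun h01 => by
    simpa using congrArg φ h01⟩⟩
  rw [injective_iff_map_eq_zero]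
  intro z hz
  obtain ⟨F, rfl⟩ := AdjoinRoot.mk_surjective z
  rw [← AdjoinRoot.mk_leftInverse (hyperbolaPoly_monic s) (AdjoinRoot.mk _ F)] at hz ⊢
  rw [AdjoinRoot.modByMonicHom_mk] at hz ⊢
  have hdeg : (F %ₘ hyperbolaPoly s).natDegree ≤ 1 := by
    have := natDegree_modByMonic_lt F (hyperbolaPoly_monic s) (fun h1 => by
      have := hyperbolaPoly_natDegree s
      simp [h1] at this)
    rw [hyperbolaPoly_natDegree] at this
    omega
  obtain ⟨q, p, hqp⟩ := exists_eq_X_add_C_of_natDegree_le_one hdeg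
  rw [hqp] at hz ⊢
  have e1 : q.eval₂ φ (x + y) * x + p.eval₂ φ (x + y) = 0 := by
    simpa [hyperbolaLift, AdjoinRoot.lift_mk, AdjoinRoot.lift_of, AdjoinRoot.lift_root] using hz
  have hσφ : σ.comp φ = φ := RingHom.ext hσ
  have hσe : ∀ r : R[X], σ (r.eval₂ φ (x + y)) = r.eval₂ φ (x + y) := fun r => by
    rw [hom_eval₂, hσφ, map_add, hσx, hσy, add_comm]
  have e2 : q.eval₂ φ (x + y) * y + p.eval₂ φ (x + y) = 0 := by
    have := congrArg σ e1
    rwa [map_add, map_mul, hσe, hσe, hσx, map_zero] at this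
  have e3 : q.eval₂ φ (x + y) * (x - y) = 0 := by linear_combination e1 - e2
  have e4 := (mul_eq_zero.mp e3).resolve_right (sub_ne_zero.mpr hxy)
  have hq := eval₂_add_eq_zero hφ h hx q e4
  rw [e4, zero_mul, zero_add] at e1
  rw [hq, eval₂_add_eq_zero hφ h hx p e1]
  simp

end HyperbolaLift

/-! ### Laurent monomials of the two apexes. -/

section Toric

variable (K : Type*) [Field K] {d : ℕ}

/-- The exponent map of the inclusion `K[t₁^±, …, t_d^±, s] ⊆ K[t₁^±, …, t_{d+1}^±, s]`. -/
def exponentSnoc (d : ℕ) : (Fin d → ℤ) × ℕ →+ (Fin (d + 1) → ℤ) × ℕ where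
  toFun p := (Fin.snoc (α := fun _ => ℤ) p.1 0, p.2)
  map_zero' := by
    ext i
    · refine Fin.lastCases ?_ (fun i => ?_) i <;> simp
    · rfl
  map_add' p q := by
    ext i
    · refine Fin.lastCases ?_ (fun i => ?_) i <;> simp
    · rfl

/-- The exponent map of the automorphism `t_{d+1} ↦ t_{d+1}⁻¹`. -/
def exponentReflect (d : ℕ) : (Fin (d + 1) → ℤ) × ℕ →+ (Fin (d + 1) → ℤ) × ℕ where
  toFun p := (Fin.snoc (α := fun _ => ℤ) (Fin.init p.1) (-p.1 (Fin.last d)), p.2)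
  map_zero' := by
    ext i
    · refine Fin.lastCases ?_ (fun i => ?_) i <;> simp [Fin.init]
    · rfl
  map_add' p q := by
    ext i
    · refine Fin.lastCases ?_ (fun i => ?_) i <;> simp [Fin.init, add_comm]
    · rfl

/-- The inclusion `K[t₁^±, …, t_d^±, s] → K[t₁^±, …, t_{d+1}^±, s]`. -/
noncomputable def laurentSnoc (d : ℕ) : LaurentRing K d →ₐ[K] LaurentRing K (d + 1) :=
  AddMonoidAlgebra.mapDomainAlgHom K K (exponentSnoc d)

/-- The automorphism `t_{d+1} ↦ t_{d+1}⁻¹` of `K[t₁^±, …, t_{d+1}^±, s]`. -/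
noncomputable def laurentReflect (d : ℕ) : LaurentRing K (d + 1) →ₐ[K] LaurentRing K (d + 1) :=
  AddMonoidAlgebra.mapDomainAlgHom K K (exponentReflect d)

/-- The monomial `t_{d+1}^k s`. -/
noncomputable def apexMonomial (d : ℕ) (k : ℤ) : LaurentRing K (d + 1) :=
  laurentMonomial K (Fin.snoc (α := fun _ => ℤ) (0 : Fin d → ℤ) k)

theorem laurentSnoc_single (p : (Fin d → ℤ) × ℕ) (c : K) :
    laurentSnoc K d (AddMonoidAlgebra.single p c) =
      AddMonoidAlgebra.single (exponentSnoc d p) c := by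
  simp [laurentSnoc]

theorem laurentReflect_single (p : (Fin (d + 1) → ℤ) × ℕ) (c : K) :
    laurentReflect K d (AddMonoidAlgebra.single p c) =
      AddMonoidAlgebra.single (exponentReflect d p) c := by
  simp [laurentReflect]

theorem laurentSnoc_laurentMonomial (a : Fin d → ℤ) :
    laurentSnoc K d (laurentMonomial K a) =
      laurentMonomial K (Fin.snoc (α := fun _ => ℤ) a 0) := by
  rw [laurentMonomial, laurentSnoc_single]
  rfl

theorem exponentSnoc_injective (d : ℕ) : Function.Injective (exponentSnoc d) := by
  intro p q h
  have h1 := congrArg (fun z => Fin.init z.1) h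
  have h2 := congrArg (fun z => z.2) h
  simp only [exponentSnoc, AddMonoidHom.coe_mk, ZeroHom.coe_mk, Fin.init_snoc] at h1 h2
  exact Prod.ext h1 h2

theorem laurentSnoc_injective (d : ℕ) : Function.Injective (laurentSnoc K d) :=
  AddMonoidAlgebra.mapDomain_injective (exponentSnoc_injective d)

theorem laurentReflect_laurentSnoc (f : LaurentRing K d) :
    laurentReflect K d (laurentSnoc K d f) = laurentSnoc K d f := by
  induction f using AddMonoidAlgebra.induction_linear with
  | zero => simp
  | add f g hf hg => rw [map_add, map_add, hf, hg]
  | single p c =>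
    rw [laurentSnoc_single, laurentReflect_single]
    congr 1
    ext i
    · refine Fin.lastCases ?_ (fun i => ?_) i <;> simp [exponentReflect, exponentSnoc]
    · rfl

theorem laurentReflect_apexMonomial (k : ℤ) :
    laurentReflect K d (apexMonomial K d k) = apexMonomial K d (-k) := by
  rw [apexMonomial, laurentMonomial, laurentReflect_single, apexMonomial, laurentMonomial]
  simp [exponentReflect]

theorem apexMonomial_mul :
    apexMonomial K d 1 * apexMonomial K d (-1) =
      laurentSnoc K d (laurentMonomial K (0 : Fin d → ℤ) ^ 2) := by
  rw [map_pow, laurentSnoc_laurentMonomial, sq]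
  simp only [apexMonomial, laurentMonomial, AddMonoidAlgebra.single_mul_single, Prod.mk_add_mk]
  congr 2
  ext i
  refine Fin.lastCases ?_ (fun i => ?_) i <;> simp

theorem apexMonomial_ne : apexMonomial K d 1 ≠ apexMonomial K d (-1) := by
  intro h
  have h1 := AddMonoidAlgebra.single_left_injective (R := K) one_ne_zero h
  have h2 := congrFun (congrArg Prod.fst h1) (Fin.last d)
  simp at h2

/-- The exponent map of the multiplication by `t_{d+1}^i s^i`. -/
def exponentShift (d i : ℕ) (p : (Fin d → ℤ) × ℕ) : (Fin (d + 1) → ℤ) × ℕ :=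
  (Fin.snoc (α := fun _ => ℤ) p.1 (i : ℤ), p.2 + i)

theorem exponentShift_eq_iff {i j : ℕ} {p q : (Fin d → ℤ) × ℕ} :
    exponentShift d i p = exponentShift d j q ↔ i = j ∧ p = q := by
  refine ⟨fun h => ?_, fun h => by rw [h.1, h.2]⟩
  have h1 := congrArg (fun z => Fin.init z.1) h
  have h2 := congrArg (fun z => z.2) h
  have h3 := congrFun (congrArg Prod.fst h) (Fin.last d)
  simp only [exponentShift, Fin.init_snoc, Fin.snoc_last, Nat.cast_inj] at h1 h2 h3
  exact ⟨h3, Prod.ext h1 (by omega)⟩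

theorem laurentSnoc_mul_apexMonomial_pow (f : LaurentRing K d) (i : ℕ) :
    laurentSnoc K d f * apexMonomial K d 1 ^ i =
      AddMonoidAlgebra.mapDomain (exponentShift d i) f := by
  induction f using AddMonoidAlgebra.induction_linear with
  | zero => simp
  | add f g hf hg => rw [map_add, add_mul, hf, hg, AddMonoidAlgebra.mapDomain_add]
  | single p c =>
    rw [laurentSnoc_single, apexMonomial, laurentMonomial, AddMonoidAlgebra.single_pow,
      AddMonoidAlgebra.single_mul_single, AddMonoidAlgebra.mapDomain_single, one_pow, mul_one]
    congr 1
    ext j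
    · refine Fin.lastCases ?_ (fun j => ?_) j <;> simp [exponentSnoc, exponentShift]
    · simp [exponentSnoc, exponentShift]

/-- The exponent of `t_{d+1}` separates the powers of the apex monomial, so distinct coefficients of
`p` contribute disjoint sets of monomials. -/
theorem eval₂_apexMonomial_eq_zero (p : Polynomial (LaurentRing K d))
    (hp : p.eval₂ (laurentSnoc K d : LaurentRing K d →+* LaurentRing K (d + 1))
      (apexMonomial K d 1) = 0) : p = 0 := by
  rw [Polynomial.eval₂_eq_sum] at hp
  ext i q
  have hinj : Function.Injective (exponentShift d i) := fun _ _ h => (exponentShift_eq_iff.mp h).2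
  have h := congrArg (fun f => f.coeff (exponentShift d i q)) hp
  simp only [Polynomial.sum, RingHom.coe_coe, laurentSnoc_mul_apexMonomial_pow,
    AddMonoidAlgebra.coeff_sum, Finsupp.finsetSum_apply, AddMonoidAlgebra.coeff_zero,
    Finsupp.zero_apply] at h
  rw [Finset.sum_eq_single i] at h
  · simpa [AddMonoidAlgebra.coeff_mapDomain, Finsupp.mapDomain_apply hinj] using h
  · intro j _ hji
    rw [AddMonoidAlgebra.coeff_mapDomain]
    refine Finsupp.mapDomain_of_notMem_range _ _ ?_
    rintro ⟨r, hr⟩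
    exact hji (exponentShift_eq_iff.mp hr).1
  · intro hi
    rw [Polynomial.notMem_support_iff.mp hi]
    simp

end Toric

/-! ### The toric ring of the bipyramid as an extension of `K[P]`. -/

section ToricRing

variable (K : Type*) [Field K] {d : ℕ}

theorem laurentMonomial_mem {P : Set (Fin d → ℝ)} {a : Fin d → ℤ} (ha : latticePoint a ∈ P) :
    laurentMonomial K a ∈ toricRing K P :=
  Algebra.subset_adjoin ⟨a, ha, rfl⟩

theorem toricRing_isNoetherianRing {P : Set (Fin d → ℝ)}
    (hfin : {a : Fin d → ℤ | latticePoint a ∈ P}.Finite) : IsNoetherianRing (toricRing K P) := by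
  have hset : {f | ∃ a : Fin d → ℤ, latticePoint a ∈ P ∧ f = laurentMonomial K a} =
      laurentMonomial K '' {a : Fin d → ℤ | latticePoint a ∈ P} := by
    ext f
    simp [eq_comm]
  have hfg : (toricRing K P).FG := by
    rw [toricRing, hset]
    exact Subalgebra.fg_def.mpr ⟨_, hfin.image _, rfl⟩
  have : Algebra.FiniteType K (toricRing K P) := Subalgebra.fg_iff_finiteType _ |>.mp hfg
  exact Algebra.FiniteType.isNoetherianRing K _

theorem toricMaximalIdeal_ne_top (P : Set (Fin d → ℝ)) : toricMaximalIdeal K P ≠ ⊤ := by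
  -- Evaluation at `s = 0`, `t_i = 1`: as `0 ^ 0 = 1` it is unital, and it kills every generator.
  let χ : Multiplicative ((Fin d → ℤ) × ℕ) →* K :=
    { toFun := fun p => 0 ^ (Multiplicative.toAdd p).2
      map_one' := by simp
      map_mul' := fun p q => by simp [pow_add] }
  let f : LaurentRing K d →ₐ[K] K := AddMonoidAlgebra.lift K K _ χ
  have hf : ∀ a : Fin d → ℤ, f (laurentMonomial K a) = 0 := fun a => by
    simp [f, χ, laurentMonomial, AddMonoidAlgebra.lift_single]
  intro htop
  have hle : toricMaximalIdeal K P ≤ RingHom.ker (f.comp (toricRing K P).val) := by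
    refine Ideal.span_le.mpr ?_
    rintro g ⟨a, -, hg⟩
    rw [SetLike.mem_coe, RingHom.mem_ker, AlgHom.comp_apply, Subalgebra.coe_val, hg, hf]
  exact RingHom.ker_ne_top _ (top_le_iff.mp (htop ▸ hle))

/-- If the lattice points of `Q ⊆ ℝ^(d+1)` are those of `P × {0}` together with `(0, ±1)`, then
the depth of `K[Q]` is one more than that of `K[P]`. -/
theorem toricDepth_eq_add_one {P : Set (Fin d → ℝ)} {Q : Set (Fin (d + 1) → ℝ)}
    (hfin : {a : Fin d → ℤ | latticePoint a ∈ P}.Finite)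
    (h0 : latticePoint (0 : Fin d → ℤ) ∈ P)
    (hQ : ∀ b : Fin (d + 1) → ℤ, latticePoint b ∈ Q ↔
      (∃ a : Fin d → ℤ, latticePoint a ∈ P ∧ b = Fin.snoc (α := fun _ => ℤ) a 0) ∨
        b = Fin.snoc (α := fun _ => ℤ) (0 : Fin d → ℤ) 1 ∨
        b = Fin.snoc (α := fun _ => ℤ) (0 : Fin d → ℤ) (-1)) :
    toricDepth K Q = toricDepth K P + 1 := by
  have := toricRing_isNoetherianRing K hfin
  let s : toricRing K P := ⟨laurentMonomial K 0, laurentMonomial_mem K h0⟩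
  have hs : s ∈ toricMaximalIdeal K P := Ideal.subset_span ⟨0, h0, rfl⟩
  let φ : toricRing K P →+* LaurentRing K (d + 1) :=
    ((laurentSnoc K d).comp (toricRing K P).val : toricRing K P →ₐ[K] LaurentRing K (d + 1))
  have hφ : Function.Injective φ := (laurentSnoc_injective K d).comp Subtype.val_injective
  have hφK : ∀ c : K, φ (algebraMap K _ c) = algebraMap K _ c := fun c =>
    AlgHom.commutes ((laurentSnoc K d).comp (toricRing K P).val) c
  have hxy : apexMonomial K d 1 * apexMonomial K d (-1) = φ (s ^ 2) := apexMonomial_mul K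
  have htrans : ∀ p : Polynomial (toricRing K P), p.eval₂ φ (apexMonomial K d 1) = 0 → p = 0 := by
    intro p hp
    have h1 := eval₂_apexMonomial_eq_zero K (p.map (toricRing K P).val.toRingHom) (by
      rw [Polynomial.eval₂_map]
      exact hp)
    exact (Polynomial.map_eq_zero_iff Subtype.val_injective).mp h1
  let θ := hyperbolaLift φ (apexMonomial K d 1) (apexMonomial K d (-1)) hxy
  have hinj : Function.Injective θ :=
    hyperbolaLift_injective hφ hxy htrans (apexMonomial_ne K) (laurentReflect K d : _ →+* _)
      (fun a => laurentReflect_laurentSnoc K _) (laurentReflect_apexMonomial K 1)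
      (by simpa using laurentReflect_apexMonomial K (d := d) (-1))
  have hx : apexMonomial K d 1 ∈ toricRing K Q :=
    laurentMonomial_mem K ((hQ _).mpr (Or.inr (Or.inl rfl)))
  have hy : apexMonomial K d (-1) ∈ toricRing K Q :=
    laurentMonomial_mem K ((hQ _).mpr (Or.inr (Or.inr rfl)))
  have hφQ : ∀ a, φ a ∈ toricRing K Q := by
    intro a
    have hle : toricRing K P ≤ (toricRing K Q).comap (laurentSnoc K d) := by
      refine Algebra.adjoin_le ?_
      rintro f ⟨a, ha, rfl⟩
      change laurentSnoc K d _ ∈ toricRing K Q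
      rw [laurentSnoc_laurentMonomial]
      exact laurentMonomial_mem K ((hQ _).mpr (Or.inl ⟨a, ha, rfl⟩))
    exact hle a.2
  have hθQ : ∀ z, θ z ∈ toricRing K Q :=
    hyperbolaLift_mem φ _ _ hxy (S := (toricRing K Q).toSubring) hφQ hx hy
  have hθsurj : ∀ f ∈ toricRing K Q, ∃ z, θ z = f := by
    intro f hf
    change f ∈ θ.range
    induction hf using Algebra.adjoin_induction with
    | mem f hf =>
      obtain ⟨b, hb, rfl⟩ := hf
      rcases (hQ b).mp hb with ⟨a, ha, rfl⟩ | rfl | rfl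
      · refine ⟨hyperbolaC s ⟨_, laurentMonomial_mem K ha⟩, ?_⟩
        rw [hyperbolaLift_C]
        exact laurentSnoc_laurentMonomial K a
      · exact ⟨hyperbolaX s, hyperbolaLift_X ..⟩
      · exact ⟨hyperbolaY s, hyperbolaLift_Y ..⟩
    | algebraMap c => exact ⟨hyperbolaC s (algebraMap K _ c), by rw [hyperbolaLift_C, hφK]⟩
    | add f g _ _ hf hg => exact θ.range.add_mem hf hg
    | mul f g _ _ hf hg => exact θ.range.mul_mem hf hg
  let e : HyperbolaRing s ≃+* toricRing K Q :=
    RingEquiv.ofBijective (θ.codRestrict (toricRing K Q) hθQ)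
      ⟨fun z w h => hinj (congrArg Subtype.val h), fun f => by
        obtain ⟨z, hz⟩ := hθsurj f f.2
        exact ⟨z, Subtype.ext hz⟩⟩
  have he : ∀ z, (e z : LaurentRing K (d + 1)) = θ z := fun z => rfl
  have hmap : (hyperbolaIdeal (toricMaximalIdeal K P) s).map e = toricMaximalIdeal K Q := by
    refine le_antisymm ?_ ?_
    · rw [Ideal.map_le_iff_le_comap]
      refine sup_le ?_ (Ideal.span_le.mpr ?_)
      · rw [Ideal.map_le_iff_le_comap]
        refine Ideal.span_le.mpr ?_
        rintro f ⟨a, ha, hf⟩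
        refine Ideal.subset_span ⟨_, (hQ _).mpr (Or.inl ⟨a, ha, rfl⟩), ?_⟩
        rw [he, hyperbolaLift_C, ← laurentSnoc_laurentMonomial, ← hf]
        rfl
      · rintro z (rfl | rfl)
        · exact Ideal.subset_span ⟨_, (hQ _).mpr (Or.inr (Or.inl rfl)), by
            rw [he, hyperbolaLift_X]; rfl⟩
        · exact Ideal.subset_span ⟨_, (hQ _).mpr (Or.inr (Or.inr rfl)), by
            rw [he, hyperbolaLift_Y]; rfl⟩
    · refine Ideal.span_le.mpr ?_
      rintro f ⟨b, hb, hf⟩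
      have key : ∀ z ∈ hyperbolaIdeal (toricMaximalIdeal K P) s, θ z = laurentMonomial K b →
          f ∈ (hyperbolaIdeal (toricMaximalIdeal K P) s).map e := by
        intro z hz hzb
        have : f = e z := Subtype.ext (by rw [he, hzb, hf])
        rw [this]
        exact Ideal.mem_map_of_mem e hz
      rcases (hQ b).mp hb with ⟨a, ha, rfl⟩ | rfl | rfl
      · refine key (hyperbolaC s ⟨_, laurentMonomial_mem K ha⟩)
          (hyperbolaC_mem s (Ideal.subset_span ⟨a, ha, rfl⟩)) ?_
        rw [hyperbolaLift_C]
        exact laurentSnoc_laurentMonomial K a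
      · exact key _ (hyperbolaX_mem _ s) (hyperbolaLift_X ..)
      · exact key _ (hyperbolaY_mem _ s) (hyperbolaLift_Y ..)
  rw [toricDepth, ← idealGrade_eq_of_ringEquiv e hmap,
    idealGrade_hyperbolaIdeal (toricMaximalIdeal_ne_top K P) hs, toricDepth]

end ToricRing

/-! ### Convex geometry and lattice points of the bipyramid. -/

section Bipyramid

variable {d : ℕ}

/-- The linear equivalence `ℝ^d × ℝ ≃ ℝ^(d+1)`, `(a, h) ↦ (a, h)`. -/
def appendEquiv (d : ℕ) : ((Fin d → ℝ) × ℝ) ≃ₗ[ℝ] (Fin (d + 1) → ℝ) where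
  toFun p := appendCoord p.1 p.2
  invFun x := (Fin.init x, x (Fin.last d))
  map_add' p q := by
    ext i
    refine Fin.lastCases ?_ (fun i => ?_) i <;> simp [appendCoord]
  map_smul' c p := by
    ext i
    refine Fin.lastCases ?_ (fun i => ?_) i <;> simp [appendCoord]
  left_inv p := by simp [appendCoord]
  right_inv x := by simp [appendCoord]

theorem appendEquiv_apply (p : (Fin d → ℝ) × ℝ) : appendEquiv d p = appendCoord p.1 p.2 := rfl

theorem appendCoord_inj {a b : Fin d → ℝ} {h k : ℝ} :
    appendCoord a h = appendCoord b k ↔ a = b ∧ h = k := by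
  rw [← Prod.mk_inj, ← (appendEquiv d).injective.eq_iff]
  rfl

theorem appendCoord_add (a b : Fin d → ℝ) (h k : ℝ) :
    appendCoord a h + appendCoord b k = appendCoord (a + b) (h + k) :=
  ((appendEquiv d).map_add (a, h) (b, k)).symm

theorem smul_appendCoord (c : ℝ) (a : Fin d → ℝ) (h : ℝ) :
    c • appendCoord a h = appendCoord (c • a) (c * h) :=
  ((appendEquiv d).map_smul c (a, h)).symm

theorem dotProduct_appendCoord (a b : Fin d → ℝ) (h k : ℝ) :
    appendCoord a h ⬝ᵥ appendCoord b k = a ⬝ᵥ b + h * k := by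
  simp [dotProduct, Fin.sum_univ_castSucc, appendCoord]

theorem latticePoint_snoc (a : Fin d → ℤ) (h : ℤ) :
    latticePoint (Fin.snoc (α := fun _ => ℤ) a h) = appendCoord (latticePoint a) (h : ℝ) := by
  ext i
  refine Fin.lastCases ?_ (fun i => ?_) i <;> simp [appendCoord, latticePoint]

theorem latticePoint_injective : Function.Injective (latticePoint (d := d)) :=
  fun _ _ h => funext fun i => Int.cast_injective (congrFun h i)

theorem appendCoord_mem_range_latticePoint {a : Fin d → ℝ} (ha : a ∈ Set.range latticePoint)
    (h : ℤ) : appendCoord a (h : ℝ) ∈ Set.range latticePoint := by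
  obtain ⟨a, rfl⟩ := ha
  exact ⟨_, latticePoint_snoc a h⟩

theorem IsPolytope.convex {P : Set (Fin d → ℝ)} (hP : IsPolytope P) : Convex ℝ P := by
  obtain ⟨F, -, rfl⟩ := hP
  exact convex_convexHull ℝ F

theorem IsPolytope.isBounded {P : Set (Fin d → ℝ)} (hP : IsPolytope P) :
    Bornology.IsBounded P := by
  obtain ⟨F, hF, rfl⟩ := hP
  exact isBounded_convexHull.mpr hF.isBounded

theorem finite_latticePoint_mem {P : Set (Fin d → ℝ)} (hP : Bornology.IsBounded P) :
    {a : Fin d → ℤ | latticePoint a ∈ P}.Finite := by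
  obtain ⟨r, hr⟩ := hP.exists_norm_le
  refine (Set.Finite.pi' (t := fun _ : Fin d => Set.Icc (-⌊r⌋) ⌊r⌋)
    fun _ => Set.finite_Icc _ _).subset fun a ha i => ?_
  have h := (norm_le_pi_norm (latticePoint a) i).trans (hr _ ha)
  rw [latticePoint, Real.norm_eq_abs, ← Int.cast_abs, ← Int.le_floor, abs_le] at h
  exact h

theorem appendCoord_zero_mem_bipyr {P : Set (Fin d → ℝ)} {a : Fin d → ℝ} (ha : a ∈ P) :
    appendCoord a 0 ∈ bipyr P :=
  subset_convexHull ℝ _ (Or.inl ⟨a, ha, rfl⟩)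

theorem zero_appendCoord_mem_bipyr {P : Set (Fin d → ℝ)} {h : ℝ} (hh : |h| ≤ 1) :
    appendCoord 0 h ∈ bipyr P := by
  have h1 : appendCoord (0 : Fin d → ℝ) 1 ∈ bipyr P := subset_convexHull ℝ _ (Or.inr (by simp))
  have h2 : appendCoord (0 : Fin d → ℝ) (-1) ∈ bipyr P :=
    subset_convexHull ℝ _ (Or.inr (by simp))
  rw [abs_le] at hh
  have h3 := convex_convexHull ℝ _ h1 h2 (a := (1 + h) / 2) (b := (1 - h) / 2)
    (by linarith) (by linarith) (by ring)
  rw [smul_appendCoord, smul_appendCoord, appendCoord_add] at h3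
  convert! h3 using 2
  · simp
  · ring

/-- The bipyramid is the join of the convex set `P × {0}` and the segment between the apexes. -/
theorem exists_of_mem_bipyr {P : Set (Fin d → ℝ)} (hP : Convex ℝ P) (hne : P.Nonempty)
    {z : Fin (d + 1) → ℝ} (hz : z ∈ bipyr P) : ∃ α β c : ℝ, ∃ a ∈ P, 0 ≤ α ∧ 0 ≤ β ∧ α + β = 1 ∧
      |c| ≤ 1 ∧ z = appendCoord (α • a) (β * c) := by
  have himg : (fun a => appendCoord a 0) '' P =
      ((appendEquiv d).toLinearMap ∘ₗ LinearMap.inl ℝ (Fin d → ℝ) ℝ) '' P := rfl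
  have hconv : Convex ℝ ((fun a => appendCoord a 0) '' P) := by
    rw [himg]
    exact hP.linear_image _
  rw [bipyr, convexHull_union (hne.image _) (Set.insert_nonempty _ _), hconv.convexHull_eq,
    convexHull_pair, mem_convexJoin] at hz
  obtain ⟨_, ⟨a, ha, rfl⟩, _, ⟨u, v, hu, hv, huv, rfl⟩, α, β, hα, hβ, hαβ, rfl⟩ := hz
  refine ⟨α, β, u - v, a, ha, hα, hβ, hαβ, abs_le.mpr ⟨by linarith, by linarith⟩, ?_⟩
  simp only [smul_appendCoord, appendCoord_add, appendCoord_inj, smul_zero, add_zero]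
  exact ⟨trivial, by ring⟩

theorem zero_mem_interior_bipyr {P : Set (Fin d → ℝ)} (hP : (0 : Fin d → ℝ) ∈ interior P) :
    (0 : Fin (d + 1) → ℝ) ∈ interior (bipyr P) := by
  rw [mem_interior_iff_mem_nhds] at hP ⊢
  have hc0 : Continuous fun z : Fin (d + 1) → ℝ => (Fin.init z : Fin d → ℝ) :=
    continuous_pi fun i => continuous_apply (A := fun _ : Fin (d + 1) => ℝ) (Fin.castSucc i)
  have hc1 : Continuous fun z : Fin (d + 1) → ℝ => (2 : ℝ) • (Fin.init z : Fin d → ℝ) :=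
    hc0.fun_const_smul (2 : ℝ)
  have hc2 : Continuous fun z : Fin (d + 1) → ℝ => 2 * z (Fin.last d) :=
    continuous_const.mul (continuous_apply _)
  -- The factors `2` let `(a, h)` be the midpoint of `(2a, 0)` and `(0, 2h)`.
  have h1 : ∀ᶠ z in nhds (0 : Fin (d + 1) → ℝ), (2 : ℝ) • (Fin.init z : Fin d → ℝ) ∈ P := by
    refine hc1.continuousAt.eventually_mem ?_
    convert! hP
    ext i
    simp [Fin.init]
  have h2 : ∀ᶠ z in nhds (0 : Fin (d + 1) → ℝ), 2 * z (Fin.last d) ∈ Set.Icc (-1 : ℝ) 1 :=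
    hc2.continuousAt.eventually_mem (by simp)
  filter_upwards [h1, h2] with z hz1 hz2
  have h3 := convex_convexHull ℝ _ (appendCoord_zero_mem_bipyr hz1)
    (zero_appendCoord_mem_bipyr (abs_le.mpr hz2)) (a := 1 / 2) (b := 1 / 2)
    (by norm_num) (by norm_num) (by norm_num)
  rw [smul_appendCoord, smul_appendCoord, appendCoord_add] at h3
  convert! h3 using 1
  ext i
  refine Fin.lastCases ?_ (fun i => ?_) i <;> simp [appendCoord, Fin.init]

theorem polytopeDim_eq_of_interior {P : Set (Fin d → ℝ)} (hP : (interior P).Nonempty) :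
    polytopeDim P = d := by
  rw [polytopeDim, AffineSubspace.vectorSpan_eq_top_of_affineSpan_eq_top ℝ _ _
    (affineSpan_eq_top_of_nonempty_interior (hP.mono (interior_mono (subset_convexHull ℝ P)))),
    finrank_top, Module.finrank_fin_fun]

theorem isLatticePolytope_bipyr {P : Set (Fin d → ℝ)} (hP : IsLatticePolytope P) :
    IsLatticePolytope (bipyr P) := by
  obtain ⟨⟨F, hF, hPF⟩, hext⟩ := hP
  refine ⟨⟨(fun a => appendCoord a 0) '' F ∪ {appendCoord 0 1, appendCoord 0 (-1)},
    (hF.image _).union (by simp), ?_⟩, fun z hz => ?_⟩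
  · have himg : ∀ S : Set (Fin d → ℝ), (fun a => appendCoord a 0) '' S =
        ((appendEquiv d).toLinearMap ∘ₗ LinearMap.inl ℝ (Fin d → ℝ) ℝ) '' S := fun _ => rfl
    rw [bipyr, hPF, himg, himg, LinearMap.image_convexHull, convexHull_convexHull_union_left]
  · rcases extremePoints_convexHull_subset hz with ⟨a, ha, rfl⟩ | rfl | rfl
    -- An extreme point of a convex hull is one of the generators; if it is `(a, 0)`, then `a` is
    -- extreme in `P`, hence a lattice point.
    · have hext' : a ∈ P.extremePoints ℝ := by
        refine ⟨ha, fun x hx y hy hxy => ?_⟩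
        have h := hz.2 (appendCoord_zero_mem_bipyr hx) (appendCoord_zero_mem_bipyr hy) (by
          obtain ⟨u, v, hu, hv, huv, rfl⟩ := hxy
          refine ⟨u, v, hu, hv, huv, ?_⟩
          simp [smul_appendCoord, appendCoord_add])
        exact (appendCoord_inj.mp h).1
      simpa using appendCoord_mem_range_latticePoint (hext hext') 0
    · simpa using appendCoord_mem_range_latticePoint (d := d) ⟨0, by ext; simp [latticePoint]⟩ 1
    · simpa using appendCoord_mem_range_latticePoint (d := d) ⟨0, by ext; simp [latticePoint]⟩ (-1)

/-- A linear inequality need only be tested on generators: `P × {0}` constrains `x`, the apexes give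
`|k| ≤ 1`. -/
theorem dualPolytope_bipyr (P : Set (Fin d → ℝ)) :
    dualPolytope (bipyr P) = appendEquiv d '' (dualPolytope P ×ˢ Set.Icc (-1) 1) := by
  ext z
  obtain ⟨⟨x, k⟩, rfl⟩ := (appendEquiv d).surjective z
  rw [(appendEquiv d).injective.mem_set_image, appendEquiv_apply]
  constructor
  · intro h
    have h1 := h _ (zero_appendCoord_mem_bipyr (h := 1) (by simp))
    have h2 := h _ (zero_appendCoord_mem_bipyr (h := -1) (by simp))
    rw [dotProduct_appendCoord] at h1 h2
    simp only [dotProduct_zero] at h1 h2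
    refine ⟨fun a ha => ?_, by constructor <;> simp only <;> linarith⟩
    simpa [dotProduct_appendCoord] using h _ (appendCoord_zero_mem_bipyr ha)
  · rintro ⟨hx, hk1, hk2⟩
    simp only at hx hk1 hk2
    have hconv : Convex ℝ {y | appendCoord x k ⬝ᵥ y ≤ 1} :=
      convex_halfSpace_le ⟨dotProduct_add _, fun c y => dotProduct_smul c _ y⟩ 1
    have hsub : bipyr P ⊆ {y | appendCoord x k ⬝ᵥ y ≤ 1} := by
      refine convexHull_min ?_ hconv
      rintro y (⟨a, ha, rfl⟩ | rfl | rfl)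
      · simpa [dotProduct_appendCoord] using hx a ha
      · simpa [dotProduct_appendCoord] using hk2
      · simp only [Set.mem_ofPred_eq, dotProduct_appendCoord, dotProduct_zero]
        linarith
    exact fun y hy => hsub hy

theorem isLatticePolytope_dualPolytope_bipyr {P : Set (Fin d → ℝ)}
    (hP : IsLatticePolytope (dualPolytope P)) : IsLatticePolytope (dualPolytope (bipyr P)) := by
  obtain ⟨⟨F, hF, hPF⟩, hext⟩ := hP
  rw [dualPolytope_bipyr]
  refine ⟨⟨appendEquiv d '' (F ×ˢ {-1, 1}), (hF.prod (by simp)).image _, ?_⟩, ?_⟩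
  · have := (appendEquiv d).toLinearMap.image_convexHull (F ×ˢ {-1, 1})
    rw [convexHull_prod, convexHull_pair, segment_eq_Icc (by norm_num), ← hPF] at this
    exact this
  · rw [← image_extremePoints, extremePoints_prod, Set.extremePoints_Icc (by norm_num)]
    rintro _ ⟨⟨x, k⟩, ⟨hx, hk⟩, rfl⟩
    rcases hk with hk | hk
    · simp only at hk
      subst hk
      simpa using! appendCoord_mem_range_latticePoint (hext hx) (-1)
    · simp only at hk
      subst hk
      simpa using! appendCoord_mem_range_latticePoint (hext hx) 1

/-- Writing a point as `(α a, β c)`, its integral height `k` satisfies `|k| ≤ β ≤ 1`. Height `0`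
leaves `α a`, which is in `P` since `0 ∈ P`; height `±1` forces `β = 1`, `α = 0`, an apex. -/
theorem latticePoint_mem_bipyr_iff {P : Set (Fin d → ℝ)} (hP : Convex ℝ P)
    (h0 : (0 : Fin d → ℝ) ∈ P) (b : Fin (d + 1) → ℤ) : latticePoint b ∈ bipyr P ↔
      (∃ a : Fin d → ℤ, latticePoint a ∈ P ∧ b = Fin.snoc (α := fun _ => ℤ) a 0) ∨
        b = Fin.snoc (α := fun _ => ℤ) (0 : Fin d → ℤ) 1 ∨
        b = Fin.snoc (α := fun _ => ℤ) (0 : Fin d → ℤ) (-1) := by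
  have hl0 : latticePoint (0 : Fin d → ℤ) = 0 := by ext; simp [latticePoint]
  constructor
  · intro hb
    obtain ⟨α, β, c, a, ha, hα, hβ, hαβ, hc, hbz⟩ := exists_of_mem_bipyr hP ⟨0, h0⟩ hb
    obtain ⟨k, b, rfl⟩ : ∃ (k : ℤ) (b' : Fin d → ℤ), b = Fin.snoc (α := fun _ => ℤ) b' k :=
      ⟨b (Fin.last d), Fin.init b, (Fin.snoc_init_self b).symm⟩
    rw [latticePoint_snoc, appendCoord_inj] at hbz
    obtain ⟨hba, hk⟩ := hbz
    have hkβ : |(k : ℝ)| ≤ β := by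
      rw [hk, abs_mul, abs_of_nonneg hβ]
      exact mul_le_of_le_one_right hβ hc
    have hβ1 : β ≤ 1 := by linarith
    have hk1 : |k| ≤ 1 := by exact_mod_cast hkβ.trans hβ1
    by_cases hk0 : k = 0
    · subst hk0
      refine Or.inl ⟨b, ?_, rfl⟩
      rw [hba]
      have := hP ha h0 hα hβ hαβ
      rwa [smul_zero, add_zero] at this
    · have hk2 : 1 ≤ |k| := Int.one_le_abs hk0
      have hk3 : (1 : ℝ) ≤ |(k : ℝ)| := by exact_mod_cast hk2
      have hα0 : α = 0 := by linarith
      rw [hα0, zero_smul, ← hl0] at hba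
      rw [latticePoint_injective hba]
      have hk4 : |k| = 1 := le_antisymm hk1 hk2
      rcases (abs_eq zero_le_one).mp hk4 with rfl | rfl
      · exact Or.inr (Or.inl rfl)
      · exact Or.inr (Or.inr rfl)
  · rintro (⟨a, ha, rfl⟩ | rfl | rfl)
    · rw [latticePoint_snoc, Int.cast_zero]
      exact appendCoord_zero_mem_bipyr ha
    · rw [latticePoint_snoc, hl0]
      exact zero_appendCoord_mem_bipyr (by simp)
    · rw [latticePoint_snoc, hl0]
      exact zero_appendCoord_mem_bipyr (by simp)

theorem isReflexive_bipyr {P : Set (Fin d → ℝ)} (hP : IsReflexive P) : IsReflexive (bipyr P) where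
  isLatticePolytope := isLatticePolytope_bipyr hP.isLatticePolytope
  dim_eq := polytopeDim_eq_of_interior ⟨0, zero_mem_interior_bipyr hP.zero_mem_interior⟩
  zero_mem_interior := zero_mem_interior_bipyr hP.zero_mem_interior
  isLatticePolytope_dual := isLatticePolytope_dualPolytope_bipyr hP.isLatticePolytope_dual

end Bipyramid

end ReflexiveDepth

theorem mainTheorem6 {K : Type*} [Field K] {d : ℕ} (P : Set (Fin d → ℝ))
    (hP : ReflexiveDepth.IsReflexive P) :
    ReflexiveDepth.IsReflexive (ReflexiveDepth.bipyr P) ∧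
      ReflexiveDepth.polytopeDim (ReflexiveDepth.bipyr P) = d + 1 ∧
      ReflexiveDepth.toricDepth K (ReflexiveDepth.bipyr P) =
        ReflexiveDepth.toricDepth K P + 1 := by
  have hpoly := hP.isLatticePolytope.1
  have h0 : (0 : Fin d → ℝ) ∈ P := interior_subset hP.zero_mem_interior
  have hB := ReflexiveDepth.isReflexive_bipyr hP
  refine ⟨hB, hB.dim_eq, ReflexiveDepth.toricDepth_eq_add_one K
    (ReflexiveDepth.finite_latticePoint_mem hpoly.isBounded) ?_
    (ReflexiveDepth.latticePoint_mem_bipyr_iff hpoly.convex h0)⟩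
  convert! h0
  ext
  simp [ReflexiveDepth.latticePoint]
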